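/- A probability measure $\nu$ on $\mathbb{R}$ satisfies a logarithmic Sobolev inequality (LSI) with constant $c\in\mathbb{R}$ if $$\int f^2\log\frac{f^2}{\int f^2\,d\nu}\,d\nu\le c\int |f'|^2\,d\nu$$ (with finite left-hand side) for all locally absolutely continuous functions $f:\mathbb{R}\to[0,\infty)$, differentiable $\nu$-almost everywhere, with $f,f'\in L^2(\nu)$. The optimal log-Sobolev constant of $\nu$ is the infimum of all such $c$ (and $+\infty$ if there is none). Theorem 2. Let $\mu$ be a probability measure on $\mathbb{R}$ whose support is contained in an interval of length $2R$, let $\delta>0$, and let $\gamma_\delta$ be the centred Gaussian of variance $\delta$, i.e. $d\gamma_\delta(t)=(2\pi\delta)^{-1/2}\exp\left(-\frac{t^2}{2\delta}\right)dt$. Then the optimal log-Sobolev constant $c(\delta)$ of the convolution $\mu*\gamma_\delta$ satisfies $$c(\delta)\le K_1\,\frac{\delta^{3/2}R}{4R^2+\delta}\exp\left(\frac{2R^2}{\delta}\right)+K_2\,(\sqrt{\delta}+2R)^2.$$ In particular, if $\delta\le R^2$, then $$c(\delta)\le K_3\,\frac{\delta^{3/2}}{R}\exp\left(\frac{2R^2}{\delta}\right).$$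 Here one can take the absolute constants $K_1=6905$, $K_2=4989$, $K_3=7803$. -/

import Mathlib

open MeasureTheory ProbabilityTheory

noncomputable section

namespace LogSobolev

/-- The integrand `g log (g / ∫ g dμ)` of the entropy of `g`. -/
def entropyIntegrand (μ : Measure ℝ) (g : ℝ → ℝ) (x : ℝ) : ℝ :=
  g x * Real.log (g x / ∫ y, g y ∂μ)

/-- The entropy `Ent_μ(g) = ∫ g log (g / ∫ g dμ) dμ`. -/
def entropy (μ : Measure ℝ) (g : ℝ → ℝ) : ℝ :=
  ∫ x, entropyIntegrand μ g x ∂μ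

/-- The energy `ℰ(f, f) = ∫ |f'|² dμ`. -/
def energy (μ : Measure ℝ) (f : ℝ → ℝ) : ℝ :=
  ∫ x, |deriv f x| ^ 2 ∂μ

/-- The functions tested in a logarithmic Sobolev inequality: nonnegative, locally absolutely
continuous, differentiable `μ`-almost everywhere (this is automatic if `μ` has a density), with `f`
and `f'` both in `L²(μ)`. All nonnegative `C¹` functions and all nonnegative locally Lipschitz
functions with `f, f'` in `L²(μ)` are included, the latter if `μ` has a density. -/
structure IsAdmissible (μ : Measure ℝ) (f : ℝ → ℝ) : Prop where
  nonneg : ∀ x, 0 ≤ f x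
  absolutelyContinuous : ∀ a b : ℝ, AbsolutelyContinuousOnInterval f a b
  differentiable : ∀ᵐ x ∂μ, DifferentiableAt ℝ f x
  memLp : MemLp f 2 μ
  memLp_deriv : MemLp (deriv f) 2 μ

/-- `μ` satisfies a logarithmic Sobolev inequality with constant `c`: for every admissible `f`,
the entropy of `f²` is finite and at most `c` times the energy of `f`. -/
def SatisfiesLSI (μ : Measure ℝ) (c : ℝ) : Prop :=
  ∀ f : ℝ → ℝ, IsAdmissible μ f →
    Integrable (entropyIntegrand μ (fun x => f x ^ 2)) μ ∧
      entropy μ (fun x => f x ^ 2) ≤ c * energy μ f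

/-- The optimal log-Sobolev constant of `μ`: the infimum of the real constants `c` with which `μ`
satisfies a logarithmic Sobolev inequality (`⊤` if there is none). -/
def optimalConstant (μ : Measure ℝ) : EReal :=
  sInf {c : EReal | ∃ r : ℝ, c = (r : EReal) ∧ SatisfiesLSI μ r}

end LogSobolev

end

noncomputable section

namespace LogSobolev

open Set Filter Topology

/-! The mollified measure is the image of the standard Gaussian under an increasing map, and
everything rests on bounding the slope of that map. With `p` and `F` the density and distribution
function of the convolution, and `φ`, `Φ` those of the standard Gaussian, the slope is `φ(y) / p(x)`
where `Φ(y) = F(x)`. If it is at most `L` everywhere, then a logarithmic Sobolev inequality with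
constant `2 * L ^ 2` holds (`satisfiesLSI_densityMeasure`), the Gaussian case being `L = 1`.

This implication is proved by mass transport. For a probability density `g` relative to `p`, let `q`
and `T` carry `p` and `g * p` to the Gaussian. A pointwise inequality
(`mul_log_mul_le_of_transport`) bounds `g log g * p` by the derivative of `g * (T - q) * φ(q)` plus
a Fisher information term. On integration the exact derivative disappears, because Gaussian tail
bounds kill the boundary terms (`integral_mul_log_le`). This requires `g` bounded above and below;
truncation and Fatou's lemma remove the restriction.

To bound the slope with `σ = √δ`, note that `F(x)` and `σ * p(x)` are the `μ`-averages of `Φ(s)` and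
`φ(s)`, where `s = (x - y) / σ` ranges over an interval of length `w = 2R / σ`. Concavity of `φ ∘
Φ⁻¹` works in the wrong direction, but on such an interval it can be reversed at the cost of a
factor `9 * (1 + w) * exp (w ^ 2 / 8)` (`stdPDF_le_mul_integral`). The resulting constant `162 * (σ
+ 2R) ^ 2 * exp (R ^ 2 / δ)` has half the required exponent, so the stated bounds follow by
elementary estimates. -/

/-- The distribution function of the density `p`. -/
def densityCDF (p : ℝ → ℝ) (x : ℝ) : ℝ := ∫ t in Iic x, p t

/-- A continuous positive probability density on the line. -/
structure IsPosDensity (p : ℝ → ℝ) : Prop where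
  continuous : Continuous p
  pos : ∀ x, 0 < p x
  integrable : Integrable p
  integral_eq_one : ∫ x, p x = 1

/-! ### Distribution functions of positive densities -/

namespace IsPosDensity

variable {p : ℝ → ℝ}

theorem densityCDF_sub (hp : IsPosDensity p) (x y : ℝ) :
    densityCDF p y - densityCDF p x = ∫ t in x..y, p t :=
  intervalIntegral.integral_Iic_sub_Iic hp.integrable.integrableOn hp.integrable.integrableOn

theorem hasStrictDerivAt_densityCDF (hp : IsPosDensity p) (x : ℝ) :
    HasStrictDerivAt (densityCDF p) (p x) x := by
  have h : densityCDF p = fun y => densityCDF p 0 + ∫ t in (0 : ℝ)..y, p t := by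
    ext y
    rw [← hp.densityCDF_sub]
    ring
  rw [h]
  exact (hp.continuous.integral_hasStrictDerivAt 0 x).const_add _

theorem hasDerivAt_densityCDF (hp : IsPosDensity p) (x : ℝ) :
    HasDerivAt (densityCDF p) (p x) x :=
  (hp.hasStrictDerivAt_densityCDF x).hasDerivAt

theorem continuous_densityCDF (hp : IsPosDensity p) : Continuous (densityCDF p) :=
  continuous_iff_continuousAt.2 fun x => (hp.hasDerivAt_densityCDF x).continuousAt

theorem strictMono_densityCDF (hp : IsPosDensity p) : StrictMono (densityCDF p) :=
  strictMono_of_hasDerivAt_pos hp.hasDerivAt_densityCDF hp.pos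

theorem tendsto_densityCDF_atTop (hp : IsPosDensity p) :
    Tendsto (densityCDF p) atTop (𝓝 1) := by
  have := (aecover_Iic (μ := volume) tendsto_id).integral_tendsto_of_countably_generated
    hp.integrable
  rwa [hp.integral_eq_one] at this

theorem tendsto_densityCDF_atBot (_  : IsPosDensity p) :
    Tendsto (densityCDF p) atBot (𝓝 0) :=
  tendsto_integral_Iic_zero tendsto_id

theorem densityCDF_pos (hp : IsPosDensity p) (x : ℝ) : 0 < densityCDF p x :=
  (setIntegral_nonneg measurableSet_Iic fun t _ => (hp.pos t).le).trans_lt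
    (hp.strictMono_densityCDF (sub_one_lt x))

theorem densityCDF_add_integral_Ioi (hp : IsPosDensity p) (x : ℝ) :
    densityCDF p x + ∫ t in Ioi x, p t = 1 := by
  rw [densityCDF, intervalIntegral.integral_Iic_add_Ioi hp.integrable.integrableOn
    hp.integrable.integrableOn, hp.integral_eq_one]

theorem densityCDF_lt_one (hp : IsPosDensity p) (x : ℝ) : densityCDF p x < 1 := by
  refine (hp.strictMono_densityCDF (lt_add_one x)).trans_le ?_
  have h := hp.densityCDF_add_integral_Ioi (x + 1)
  have h' : 0 ≤ ∫ t in Ioi (x + 1), p t :=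
    setIntegral_nonneg measurableSet_Ioi fun t _ => (hp.pos t).le
  linarith

/-- Every level in `(0, 1)` has a quantile. -/
theorem exists_densityCDF_eq (hp : IsPosDensity p) {u : ℝ} (h0 : 0 < u) (h1 : u < 1) :
    ∃ x, densityCDF p x = u := by
  obtain ⟨a, ha⟩ := (hp.tendsto_densityCDF_atBot.eventually (gt_mem_nhds h0)).exists
  obtain ⟨b, hb⟩ := (hp.tendsto_densityCDF_atTop.eventually (lt_mem_nhds h1)).exists
  exact mem_range_of_exists_le_of_exists_ge hp.continuous_densityCDF ⟨a, ha.le⟩ ⟨b, hb.le⟩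

end IsPosDensity

/-! ### The standard Gaussian and its tails -/

/-- The standard Gaussian density. -/
def stdPDF (x : ℝ) : ℝ := gaussianPDFReal 0 1 x

/-- The standard Gaussian distribution function. -/
def stdCDF (x : ℝ) : ℝ := densityCDF stdPDF x

theorem stdPDF_eq (x : ℝ) : stdPDF x = (√(2 * Real.pi))⁻¹ * Real.exp (-x ^ 2 / 2) := by
  simp [stdPDF, gaussianPDFReal]

theorem stdPDF_eq_mul (x : ℝ) : stdPDF x = stdPDF 0 * Real.exp (-x ^ 2 / 2) := by
  simp [stdPDF_eq]

theorem stdPDF_zero_pos : 0 < stdPDF 0 := by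
  rw [stdPDF_eq]; positivity

theorem stdPDF_pos (x : ℝ) : 0 < stdPDF x := by
  rw [stdPDF_eq]; positivity

theorem stdPDF_neg (x : ℝ) : stdPDF (-x) = stdPDF x := by
  simp [stdPDF_eq]

theorem stdPDF_le_zero (x : ℝ) : stdPDF x ≤ stdPDF 0 := by
  rw [stdPDF_eq_mul x]
  refine mul_le_of_le_one_right stdPDF_zero_pos.le (Real.exp_le_one_iff.2 ?_)
  nlinarith [sq_nonneg x]

theorem hasDerivAt_stdPDF (x : ℝ) : HasDerivAt stdPDF (-x * stdPDF x) x := by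
  have h : HasDerivAt (fun y : ℝ => stdPDF 0 * Real.exp (-y ^ 2 / 2))
      (stdPDF 0 * (Real.exp (-x ^ 2 / 2) * (-(2 * x) / 2))) x := by
    have := (((hasDerivAt_pow 2 x).neg.div_const 2).exp.const_mul (stdPDF 0))
    simpa using this
  rw [funext stdPDF_eq_mul]
  convert h using 1
  ring

theorem continuous_stdPDF : Continuous stdPDF :=
  continuous_iff_continuousAt.2 fun x => (hasDerivAt_stdPDF x).continuousAt

theorem isPosDensity_stdPDF : IsPosDensity stdPDF where
  continuous := continuous_stdPDF
  pos := stdPDF_pos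
  integrable := integrable_gaussianPDFReal 0 1
  integral_eq_one := integral_gaussianPDFReal_eq_one 0 one_ne_zero

theorem strictMono_stdCDF : StrictMono stdCDF := isPosDensity_stdPDF.strictMono_densityCDF

theorem continuous_stdCDF : Continuous stdCDF := isPosDensity_stdPDF.continuous_densityCDF

theorem stdCDF_pos (x : ℝ) : 0 < stdCDF x := isPosDensity_stdPDF.densityCDF_pos x

theorem stdCDF_lt_one (x : ℝ) : stdCDF x < 1 := isPosDensity_stdPDF.densityCDF_lt_one x

theorem one_sub_stdCDF (x : ℝ) : 1 - stdCDF x = ∫ t in Ioi x, stdPDF t := by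
  rw [← isPosDensity_stdPDF.densityCDF_add_integral_Ioi x, stdCDF]
  ring

theorem stdCDF_neg (x : ℝ) : stdCDF (-x) = 1 - stdCDF x := by
  rw [one_sub_stdCDF, stdCDF, densityCDF]
  have := integral_comp_neg_Iic (-x) stdPDF
  simpa [stdPDF_neg] using this

theorem half_le_stdCDF {x : ℝ} (hx : 0 ≤ x) : 1 / 2 ≤ stdCDF x := by
  have := strictMono_stdCDF.monotone (neg_le_self hx)
  rw [stdCDF_neg] at this
  linarith

/-- The upper bound in Mills' inequality. -/
theorem mul_one_sub_stdCDF_le (x : ℝ) : x * (1 - stdCDF x) ≤ stdPDF x := by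
  have hlim : Tendsto stdPDF atTop (𝓝 0) := by
    have h1 : Tendsto (fun x : ℝ => -x ^ 2 / 2) atTop atBot := by
      simp_rw [neg_div]
      exact tendsto_neg_atTop_atBot.comp
        ((tendsto_pow_atTop two_ne_zero).atTop_div_const two_pos)
    have := (Real.tendsto_exp_atBot.comp h1).const_mul (stdPDF 0)
    rw [mul_zero] at this
    exact this.congr fun x => (stdPDF_eq_mul x).symm
  rcases le_or_gt x 0 with hx | hx
  · exact (mul_nonpos_of_nonpos_of_nonneg hx (sub_nonneg.2 (stdCDF_lt_one x).le)).trans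
      (stdPDF_pos x).le
  -- Beyond `x` the integrand `x * φ(t)` is at most `t * φ(t)`, which has antiderivative `-φ`.
  have hd : ∀ t ∈ Ici x, HasDerivAt (fun t => -stdPDF t) (t * stdPDF t) t := fun t _ => by
    have := (hasDerivAt_stdPDF t).neg
    rwa [neg_mul, neg_neg] at this
  have hpos : ∀ t ∈ Ioi x, 0 ≤ t * stdPDF t := fun t ht =>
    mul_nonneg (hx.trans ht).le (stdPDF_pos t).le
  have hlim' : Tendsto (fun t => -stdPDF t) atTop (𝓝 0) := by simpa using hlim.neg
  have hint := integrableOn_Ioi_deriv_of_nonneg' hd hpos hlim'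
  have heq := integral_Ioi_of_hasDerivAt_of_nonneg' hd hpos hlim'
  rw [one_sub_stdCDF, ← integral_const_mul]
  calc ∫ t in Ioi x, x * stdPDF t ≤ ∫ t in Ioi x, t * stdPDF t :=
        setIntegral_mono_on (isPosDensity_stdPDF.integrable.const_mul x).integrableOn hint
          measurableSet_Ioi fun t ht =>
            mul_le_mul_of_nonneg_right (le_of_lt ht) (stdPDF_pos t).le
    _ = stdPDF x := by rw [heq]; ring

/-- A lower bound of Mills type for the Gaussian tail. -/
theorem stdPDF_le_mul_one_sub_stdCDF {x : ℝ} (hx : 0 ≤ x) :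
    stdPDF x ≤ Real.exp 1 * (x + 1) * (1 - stdCDF x) := by
  have hx1 : 0 < x + 1 := by linarith
  -- On `[x, x + s]` the exponent `t ^ 2 / 2` grows by at most `x * s + s ^ 2 / 2 ≤ 1`, so the
  -- density loses at most a factor `e`.
  set s := (x + 1)⁻¹ with hs
  have hs0 : 0 < s := inv_pos.2 hx1
  have hxs : (x + 1) * s = 1 := mul_inv_cancel₀ hx1.ne'
  have hs1 : s ≤ 1 := by nlinarith
  have hlow : s * (stdPDF x * Real.exp (-1)) ≤ stdCDF (x + s) - stdCDF x := by
    rw [stdCDF, stdCDF, isPosDensity_stdPDF.densityCDF_sub]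
    have : ∫ t in x..(x + s), stdPDF x * Real.exp (-1) ≤ ∫ t in x..(x + s), stdPDF t := by
      refine intervalIntegral.integral_mono_on (by linarith) (by simp)
        (continuous_stdPDF.intervalIntegrable _ _) fun t ht => ?_
      rw [stdPDF_eq_mul x, stdPDF_eq_mul t, mul_assoc, ← Real.exp_add]
      refine mul_le_mul_of_nonneg_left (Real.exp_le_exp.2 ?_) stdPDF_zero_pos.le
      have : t ^ 2 ≤ (x + s) ^ 2 := pow_le_pow_left₀ (hx.trans ht.1) ht.2 2
      nlinarith
    rwa [intervalIntegral.integral_const, add_sub_cancel_left, smul_eq_mul] at this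
  have h1 := stdCDF_lt_one (x + s)
  have h2 : s * (stdPDF x * Real.exp (-1)) ≤ 1 - stdCDF x := by linarith
  calc stdPDF x = Real.exp 1 * (x + 1) * (s * (stdPDF x * Real.exp (-1))) := by
        rw [Real.exp_neg]
        field_simp
        linear_combination (-stdPDF x) * hxs
    _ ≤ _ := mul_le_mul_of_nonneg_left h2 (by positivity)

theorem third_le_stdPDF_zero : 1 / 3 ≤ stdPDF 0 := by
  rw [stdPDF_eq]
  simp only [ne_eq, OfNat.ofNat_ne_zero, not_false_eq_true, zero_pow, neg_zero, zero_div,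
    Real.exp_zero, mul_one]
  rw [one_div]
  refine inv_anti₀ (by positivity) ?_
  rw [Real.sqrt_le_iff]
  constructor <;> nlinarith [Real.pi_lt_d2]

/-- Mills' inequality suffices for `x ≥ 1 / 2`; below that the tail is at most `1 / 2` and the
density at least `(1 / 3) * (7 / 8)`. -/
theorem one_sub_stdCDF_le_two_mul {x : ℝ} (hx : 0 ≤ x) : 1 - stdCDF x ≤ 2 * stdPDF x := by
  rcases le_total (1 / 2) x with h | h
  · have := mul_one_sub_stdCDF_le x
    nlinarith [stdCDF_lt_one x]
  · have h1 := half_le_stdCDF hx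
    have h2 : (7 / 8 : ℝ) ≤ Real.exp (-x ^ 2 / 2) := by
      have := Real.add_one_le_exp (-x ^ 2 / 2)
      nlinarith
    have h3 := third_le_stdPDF_zero
    rw [stdPDF_eq_mul x]
    nlinarith

/-- On the half-line to the right of `b ≥ 0`, the Gaussian hazard rate is at least
`max b (1 / 2)`. -/
theorem max_mul_one_sub_stdCDF_le {b x : ℝ} (hb : 0 ≤ b) (hx : b ≤ x) :
    max b (1 / 2) * (1 - stdCDF x) ≤ stdPDF x := by
  have h1 := (stdCDF_lt_one x).le
  rcases max_cases b (1 / 2) with h | h <;> rw [h.1]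
  · exact (mul_le_mul_of_nonneg_right hx (sub_nonneg.2 h1)).trans (mul_one_sub_stdCDF_le x)
  · have := one_sub_stdCDF_le_two_mul (hb.trans hx)
    linarith

theorem tendsto_add_one_mul_stdPDF :
    Tendsto (fun x => (x + 1) * stdPDF x) atTop (𝓝 0) := by
  have h0 : Tendsto (fun x : ℝ => stdPDF 0 * (2 * (x ^ 1 * Real.exp (-x)))) atTop (𝓝 0) := by
    simpa using ((Real.tendsto_pow_mul_exp_neg_atTop_nhds_zero 1).const_mul 2).const_mul (stdPDF 0)
  refine squeeze_zero' ?_ ?_ h0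
  · filter_upwards [eventually_ge_atTop 0] with x hx
    exact mul_nonneg (by linarith) (stdPDF_pos x).le
  · filter_upwards [eventually_ge_atTop 2] with x hx
    have h1 : Real.exp (-x ^ 2 / 2) ≤ Real.exp (-x) := Real.exp_le_exp.2 (by nlinarith)
    rw [stdPDF_eq_mul x, mul_left_comm]
    refine mul_le_mul_of_nonneg_left ?_ stdPDF_zero_pos.le
    calc (x + 1) * Real.exp (-x ^ 2 / 2) ≤ (2 * x) * Real.exp (-x) :=
          mul_le_mul (by linarith) h1 (Real.exp_pos _).le (by linarith)
      _ = _ := by ring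

/-! ### Decay of the boundary terms -/

/-- If the Gaussian tail at `T` dominates a multiple of the Gaussian tail at `q`, then `T - q` is
small compared with `1 / stdPDF q`. -/
theorem abs_sub_mul_stdPDF_le {c q T : ℝ} (hc : 0 < c) (hq : 0 ≤ q) (hT : 0 ≤ T)
    (h : c * (1 - stdCDF q) ≤ 1 - stdCDF T) :
    |T - q| * stdPDF q ≤ (q + 1) * stdPDF q + Real.exp 1 / c * ((T + 1) * stdPDF T) := by
  have hφq := stdPDF_pos q
  have hφT := stdPDF_pos T
  have hE := Real.exp_pos 1
  rcases le_total T q with hTq | hTq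
  · have h1 : |T - q| ≤ q + 1 := by rw [abs_sub_comm, abs_of_nonneg] <;> linarith
    have h2 : 0 ≤ Real.exp 1 / c * ((T + 1) * stdPDF T) := by positivity
    nlinarith
  · have h1 : |T - q| ≤ T := by rw [abs_of_nonneg] <;> linarith
    have h2 : 0 ≤ (q + 1) * stdPDF q := by positivity
    -- The lower Mills bound at `q` turns the density into a tail, which the hypothesis moves to
    -- `T`; the upper Mills bound then absorbs the remaining factor `T`.
    have h3 : stdPDF q ≤ Real.exp 1 / c * ((q + 1) * (1 - stdCDF T)) := by
      calc stdPDF q ≤ Real.exp 1 * (q + 1) * (1 - stdCDF q) := stdPDF_le_mul_one_sub_stdCDF hq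
        _ = Real.exp 1 / c * ((q + 1) * (c * (1 - stdCDF q))) := by field_simp
        _ ≤ _ := by gcongr
    calc |T - q| * stdPDF q ≤ T * (Real.exp 1 / c * ((q + 1) * (1 - stdCDF T))) := by gcongr
      _ = Real.exp 1 / c * ((q + 1) * (T * (1 - stdCDF T))) := by ring
      _ ≤ Real.exp 1 / c * ((T + 1) * stdPDF T) := by
        have h4 := mul_one_sub_stdCDF_le T
        have h5 : (q + 1) * (T * (1 - stdCDF T)) ≤ (T + 1) * stdPDF T :=
          (mul_le_mul_of_nonneg_left h4 (by linarith)).trans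
            (mul_le_mul_of_nonneg_right (by linarith) hφT.le)
        gcongr
      _ ≤ _ := by linarith

theorem tendsto_sub_mul_stdPDF {α : Type*} {l : Filter α} {q T : α → ℝ} {c : ℝ} (hc : 0 < c)
    (hq : Tendsto q l atTop) (hT : Tendsto T l atTop)
    (h : ∀ x, c * (1 - stdCDF (q x)) ≤ 1 - stdCDF (T x)) :
    Tendsto (fun x => (T x - q x) * stdPDF (q x)) l (𝓝 0) := by
  have hlim : Tendsto (fun x => (q x + 1) * stdPDF (q x)
      + Real.exp 1 / c * ((T x + 1) * stdPDF (T x))) l (𝓝 0) := by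
    simpa using (tendsto_add_one_mul_stdPDF.comp hq).add
      ((tendsto_add_one_mul_stdPDF.comp hT).const_mul (Real.exp 1 / c))
  refine squeeze_zero_norm' ?_ hlim
  filter_upwards [hq.eventually_ge_atTop 0, hT.eventually_ge_atTop 0] with x h1 h2
  rw [Real.norm_eq_abs, abs_mul, abs_of_pos (stdPDF_pos _)]
  exact abs_sub_mul_stdPDF_le hc h1 h2 (h x)

/-! ### Transport and the entropy bound for bounded densities -/

/-- The increasing map transporting a positive density to the standard Gaussian. -/
theorem IsPosDensity.exists_transport {p : ℝ → ℝ} (hp : IsPosDensity p) :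
    ∃ q : ℝ → ℝ, (∀ x, stdCDF (q x) = densityCDF p x) ∧
      (∀ x, HasDerivAt q (p x / stdPDF (q x)) x) ∧
      Tendsto q atTop atTop ∧ Tendsto q atBot atBot := by
  have hex : ∀ x, ∃ y, stdCDF y = densityCDF p x := fun x =>
    isPosDensity_stdPDF.exists_densityCDF_eq (hp.densityCDF_pos x) (hp.densityCDF_lt_one x)
  have hinv : Function.LeftInverse (Function.invFun stdCDF) stdCDF :=
    Function.leftInverse_invFun strictMono_stdCDF.injective
  refine ⟨fun x => Function.invFun stdCDF (densityCDF p x), ?_, ?_, ?_, ?_⟩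
  · intro x
    exact Function.invFun_eq (hex x)
  · intro x
    obtain ⟨y, hy⟩ := hex x
    have h0 : HasStrictDerivAt stdCDF (stdPDF y) y :=
      isPosDensity_stdPDF.hasStrictDerivAt_densityCDF y
    have h1 := (h0.to_local_left_inverse (stdPDF_pos y).ne'
      (Eventually.of_forall hinv)).hasDerivAt
    rw [hy] at h1
    have h2 := h1.comp x (hp.hasDerivAt_densityCDF x)
    have h3 : Function.invFun stdCDF (densityCDF p x) = y := by rw [← hy, hinv y]
    simp only [h3, div_eq_inv_mul]
    exact h2
  · refine tendsto_atTop.2 fun M => ?_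
    filter_upwards [hp.tendsto_densityCDF_atTop.eventually (lt_mem_nhds (stdCDF_lt_one M))] with x hx
    rw [← Function.invFun_eq (hex x)] at hx
    exact (strictMono_stdCDF.lt_iff_lt.1 hx).le
  · refine tendsto_atBot.2 fun M => ?_
    filter_upwards [hp.tendsto_densityCDF_atBot.eventually (gt_mem_nhds (stdCDF_pos M))] with x hx
    rw [← Function.invFun_eq (hex x)] at hx
    exact (strictMono_stdCDF.lt_iff_lt.1 hx).le

/-- The pointwise inequality behind the transport proof of the logarithmic Sobolev inequality. -/
theorem mul_log_mul_le_of_transport {L g g' p q T : ℝ} (hg : 0 < g) (hp : 0 < p)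
    (hL : stdPDF q ≤ L * p) :
    g * Real.log g * p ≤
      g' * ((T - q) * stdPDF q) + g * ((g * p / stdPDF T - p / stdPDF q) * stdPDF q
        + (T - q) * (-q * stdPDF q * (p / stdPDF q))) + L ^ 2 / 2 * (g' ^ 2 / g * p) := by
  have hφq := stdPDF_pos q
  have hφT := stdPDF_pos T
  -- `ρ` is the ratio `T' / q'` of the slopes of the two transport maps.
  set ρ := g * stdPDF q / stdPDF T with hρ
  have hρ0 : 0 < ρ := by positivity
  have hlogφ : ∀ x, Real.log (stdPDF x) = Real.log (stdPDF 0) - x ^ 2 / 2 := fun x => by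
    rw [stdPDF_eq_mul x, Real.log_mul stdPDF_zero_pos.ne' (Real.exp_pos _).ne', Real.log_exp]
    ring
  have hlog : Real.log g = Real.log ρ + (q ^ 2 / 2 - T ^ 2 / 2) := by
    rw [hρ, Real.log_div (by positivity) hφT.ne', Real.log_mul hg.ne' hφq.ne', hlogφ q, hlogφ T]
    ring
  have hle : Real.log ρ ≤ ρ - 1 := Real.log_le_sub_one_of_pos hρ0
  -- The left side is the derivative of `(T - q) * φ(q)`. The rest of `log g` uses `q ^ 2 / 2 - T ^
  -- 2 / 2 = -(T - q) * q - (T - q) ^ 2 / 2`, whose last square pays for the cross term with `g'`.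
  have h1 : (g * p / stdPDF T - p / stdPDF q) * stdPDF q
      + (T - q) * (-q * stdPDF q * (p / stdPDF q)) = p * (ρ - 1 - (T - q) * q) := by
    rw [hρ]
    field_simp
    ring
  have h2 : (g' * stdPDF q) ^ 2 ≤ (g' * (L * p)) ^ 2 := by
    rw [mul_pow, mul_pow]
    exact mul_le_mul_of_nonneg_left (pow_le_pow_left₀ hφq.le hL 2) (sq_nonneg _)
  have h3 : 0 ≤ g' * ((T - q) * stdPDF q) + g * p * (T - q) ^ 2 / 2
      + L ^ 2 / 2 * (g' ^ 2 / g * p) := by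
    have h4 : L ^ 2 / 2 * (g' ^ 2 / g * p) = (g' * (L * p)) ^ 2 / (2 * (g * p)) := by
      field_simp
    have h5 : g' * ((T - q) * stdPDF q) + g * p * (T - q) ^ 2 / 2
        + (g' * stdPDF q) ^ 2 / (2 * (g * p))
        = (g * p * (T - q) + g' * stdPDF q) ^ 2 / (2 * (g * p)) := by
      field_simp
      ring
    have h6 : (g' * stdPDF q) ^ 2 / (2 * (g * p)) ≤ (g' * (L * p)) ^ 2 / (2 * (g * p)) := by
      gcongr
    have h7 : 0 ≤ (g * p * (T - q) + g' * stdPDF q) ^ 2 / (2 * (g * p)) := by positivity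
    rw [h4]
    linarith
  have h8 : g * p * Real.log ρ ≤ g * p * (ρ - 1) :=
    mul_le_mul_of_nonneg_left hle (by positivity)
  rw [h1, hlog]
  nlinarith

theorem continuous_of_absolutelyContinuousOnInterval {f : ℝ → ℝ}
    (hf : ∀ a b, AbsolutelyContinuousOnInterval f a b) : Continuous f :=
  continuous_iff_continuousAt.2 fun x => ((hf (x - 1) (x + 1)).continuousOn).continuousAt
    (by rw [uIcc_of_le (by linarith)]; exact Icc_mem_nhds (by linarith) (by linarith))

/-- The logarithmic Sobolev inequality, in its Fisher information form, for a probability density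
`g` relative to `p` that is bounded above and below. -/
theorem integral_mul_log_le {p g : ℝ → ℝ} {L c C : ℝ} (hp : IsPosDensity p)
    (hL : ∀ x y, stdCDF y = densityCDF p x → stdPDF y ≤ L * p x)
    (hg : ∀ a b, AbsolutelyContinuousOnInterval g a b) (hc : 0 < c) (hcg : ∀ x, c ≤ g x)
    (hgC : ∀ x, g x ≤ C) (hg1 : ∫ x, g x * p x = 1)
    (hint : Integrable fun x => deriv g x ^ 2 / g x * p x) :
    ∫ x, g x * Real.log (g x) * p x ≤ L ^ 2 / 2 * ∫ x, deriv g x ^ 2 / g x * p x := by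
  have hg0 : ∀ x, 0 < g x := fun x => hc.trans_le (hcg x)
  have hgcont := continuous_of_absolutelyContinuousOnInterval hg
  have hgbdd : ∀ x, ‖g x‖ ≤ C := fun x => by rw [Real.norm_of_nonneg (hg0 x).le]; exact hgC x
  have hr : IsPosDensity fun x => g x * p x :=
    { continuous := hgcont.mul hp.continuous
      pos := fun x => mul_pos (hg0 x) (hp.pos x)
      integrable := hp.integrable.bdd_mul hgcont.aestronglyMeasurable (ae_of_all _ hgbdd)
      integral_eq_one := hg1 }
  obtain ⟨q, hqF, hqd, hqtop, hqbot⟩ := hp.exists_transport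
  obtain ⟨T, hTF, hTd, hTtop, hTbot⟩ := hr.exists_transport
  have hqc : Continuous q := continuous_iff_continuousAt.2 fun x => (hqd x).continuousAt
  have hTc : Continuous T := continuous_iff_continuousAt.2 fun x => (hTd x).continuousAt
  have hlogint : Integrable fun x => g x * Real.log (g x) * p x := by
    have hcont : Continuous fun x => g x * Real.log (g x) :=
      hgcont.mul (hgcont.log fun x => (hg0 x).ne')
    refine hp.integrable.bdd_mul (c := C * max |Real.log c| |Real.log C|)
      hcont.aestronglyMeasurable (ae_of_all _ fun x => ?_)
    rw [norm_mul]
    refine mul_le_mul (hgbdd x) ?_ (norm_nonneg _) ((hg0 x).le.trans (hgC x))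
    exact abs_le_max_abs_abs (Real.log_le_log hc (hcg x)) (Real.log_le_log (hg0 x) (hgC x))
  set K : ℝ → ℝ := fun x => (T x - q x) * stdPDF (q x) with hK
  have hKd : ∀ x, HasDerivAt K ((g x * p x / stdPDF (T x) - p x / stdPDF (q x)) * stdPDF (q x)
      + (T x - q x) * (-q x * stdPDF (q x) * (p x / stdPDF (q x)))) x := fun x =>
    ((hTd x).sub (hqd x)).mul ((hasDerivAt_stdPDF (q x)).comp x (hqd x))
  have hKC1 : ContDiff ℝ 1 K := by
    rw [contDiff_one_iff_deriv]
    refine ⟨fun x => (hKd x).differentiableAt, ?_⟩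
    rw [funext fun x => (hKd x).deriv]
    have hφq : Continuous fun x => stdPDF (q x) := continuous_stdPDF.comp hqc
    have hφT : Continuous fun x => stdPDF (T x) := continuous_stdPDF.comp hTc
    have hpc := hp.continuous
    exact (((hr.continuous.div hφT fun x => (stdPDF_pos _).ne').sub
      (hpc.div hφq fun x => (stdPDF_pos _).ne')).mul hφq).add
      ((hTc.sub hqc).mul ((hqc.neg.mul hφq).mul (hpc.div hφq fun x => (stdPDF_pos _).ne')))
  -- Absolute continuity of `g * K` gives the fundamental theorem of calculus although `g` is
  -- differentiable only almost everywhere.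
  have hHac : ∀ a b, AbsolutelyContinuousOnInterval (g * K) a b := fun a b =>
    (hg a b).mul hKC1.contDiffOn.absolutelyContinuousOnInterval
  have hfin : ∀ n : ℕ, ∫ x in (-n : ℝ)..n, g x * Real.log (g x) * p x ≤
      (g n * K n - g (-n) * K (-n))
        + L ^ 2 / 2 * ∫ x in (-n : ℝ)..n, deriv g x ^ 2 / g x * p x := fun n => by
    have hn : (-n : ℝ) ≤ n := by linarith [Nat.cast_nonneg (α := ℝ) n]
    have hI1 := (hHac (-n) n).intervalIntegrable_deriv
    have hI2 : IntervalIntegrable (fun x => L ^ 2 / 2 * (deriv g x ^ 2 / g x * p x)) volume (-n) n :=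
      (hint.const_mul _).intervalIntegrable
    have h := intervalIntegral.integral_mono_ae_restrict hn hlogint.intervalIntegrable
      (hI1.add hI2) ?_
    · rw [intervalIntegral.integral_add hI1 hI2, (hHac (-n) n).integral_deriv_eq_sub,
        intervalIntegral.integral_const_mul] at h
      exact h
    · rw [EventuallyLE, ae_restrict_iff' measurableSet_Icc]
      filter_upwards [(hg (-n) n).ae_differentiableAt] with x hx hmem
      have hgd := (hx (by rwa [uIcc_of_le hn])).hasDerivAt
      rw [(hgd.mul (hKd x)).deriv]
      exact mul_log_mul_le_of_transport (hg0 x) (hp.pos x) (hL x (q x) (hqF x))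
  have hgpc : ∀ s, MeasurableSet s → c * ∫ t in s, p t ≤ ∫ t in s, g t * p t := fun s hs => by
    rw [← integral_const_mul]
    exact setIntegral_mono_on (hp.integrable.const_mul c).integrableOn hr.integrable.integrableOn hs
      fun t _ => mul_le_mul_of_nonneg_right (hcg t) (hp.pos t).le
  have hKtop : Tendsto K atTop (𝓝 0) := by
    refine tendsto_sub_mul_stdPDF hc hqtop hTtop fun x => ?_
    have h1 := hp.densityCDF_add_integral_Ioi x
    have h2 := hr.densityCDF_add_integral_Ioi x
    have h3 := hgpc (Ioi x) measurableSet_Ioi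
    rw [hqF, hTF]
    rwa [← sub_eq_of_eq_add' h1.symm, ← sub_eq_of_eq_add' h2.symm] at h3
  -- Reflection `x ↦ -x` of the Gaussian turns the left tail into a right tail.
  have hKbot : Tendsto K atBot (𝓝 0) := by
    have h := tendsto_sub_mul_stdPDF hc (tendsto_neg_atBot_atTop.comp hqbot)
      (tendsto_neg_atBot_atTop.comp hTbot) fun x => by
        simp only [Function.comp, stdCDF_neg, sub_sub_cancel]
        rw [hqF, hTF]
        exact hgpc (Iic x) measurableSet_Iic
    have h' := h.neg
    rw [neg_zero] at h'
    refine h'.congr fun x => ?_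
    simp only [Function.comp, stdPDF_neg, hK]
    ring
  have hgK : ∀ {u : ℕ → ℝ}, Tendsto (fun n => K (u n)) atTop (𝓝 0) →
      Tendsto (fun n => g (u n) * K (u n)) atTop (𝓝 0) := fun {u} hu => by
    refine squeeze_zero_norm (fun n => ?_) (by simpa using hu.norm.const_mul C)
    rw [norm_mul]
    exact mul_le_mul_of_nonneg_right (hgbdd _) (norm_nonneg _)
  have hnat : Tendsto (fun n : ℕ => (n : ℝ)) atTop atTop := tendsto_natCast_atTop_atTop
  have hneg : Tendsto (fun n : ℕ => -(n : ℝ)) atTop atBot := tendsto_neg_atTop_atBot.comp hnat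
  have hlim := ((hgK (hKtop.comp hnat)).sub (hgK (hKbot.comp hneg))).add
    ((intervalIntegral_tendsto_integral hint hneg hnat).const_mul (L ^ 2 / 2))
  rw [sub_zero, zero_add] at hlim
  exact le_of_tendsto_of_tendsto' (intervalIntegral_tendsto_integral hlogint hneg hnat) hlim hfin

/-! ### Reverse Jensen inequality for the Gaussian profile -/

theorem integrable_stdPDF_comp {α : Type*} [MeasurableSpace α] (μ : Measure α) [IsFiniteMeasure μ]
    {s : α → ℝ} (hs : Measurable s) : Integrable (fun y => stdPDF (s y)) μ :=
  Integrable.of_bound (continuous_stdPDF.measurable.comp hs).aestronglyMeasurable (stdPDF 0)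
    (ae_of_all _ fun y => by
      rw [Real.norm_of_nonneg (stdPDF_pos _).le]
      exact stdPDF_le_zero _)

theorem integrable_stdCDF_comp {α : Type*} [MeasurableSpace α] (μ : Measure α) [IsFiniteMeasure μ]
    {s : α → ℝ} (hs : Measurable s) : Integrable (fun y => stdCDF (s y)) μ :=
  Integrable.of_bound (continuous_stdCDF.measurable.comp hs).aestronglyMeasurable 1
    (ae_of_all _ fun y => by
      rw [Real.norm_of_nonneg (stdCDF_pos _).le]
      exact (stdCDF_lt_one _).le)

theorem stdPDF_zero_le_half : stdPDF 0 ≤ 1 / 2 := by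
  rw [stdPDF_eq]
  simp only [ne_eq, OfNat.ofNat_ne_zero, not_false_eq_true, zero_pow, neg_zero, zero_div,
    Real.exp_zero, mul_one]
  rw [one_div]
  refine inv_anti₀ (by positivity) (Real.le_sqrt_of_sq_le ?_)
  nlinarith [Real.pi_gt_three]

/-- For `x ≥ 0` the hazard rate is at least `1 / 2 ≥ φ(0)`; for `-(r / 2) ≤ x < 0` the tail is at
most `1` and `x ^ 2 / 2 ≤ r ^ 2 / 8`. -/
theorem mul_one_sub_stdCDF_le_of_neg_le {x r : ℝ} (hr : 0 ≤ r) (h : -(r / 2) ≤ x) :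
    stdPDF 0 * Real.exp (-r ^ 2 / 8) * (1 - stdCDF x) ≤ stdPDF x := by
  rcases le_or_gt 0 x with h3 | h3
  · have h4 := one_sub_stdCDF_le_two_mul h3
    have h6 : Real.exp (-r ^ 2 / 8) ≤ 1 := Real.exp_le_one_iff.2 (by nlinarith)
    have h7 : stdPDF 0 * Real.exp (-r ^ 2 / 8) ≤ 1 / 2 :=
      (mul_le_of_le_one_right stdPDF_zero_pos.le h6).trans stdPDF_zero_le_half
    nlinarith [stdCDF_lt_one x]
  · refine (mul_le_of_le_one_right (mul_nonneg stdPDF_zero_pos.le (Real.exp_pos _).le)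
      (sub_le_self _ (stdCDF_pos _).le)).trans ?_
    rw [stdPDF_eq_mul x]
    refine mul_le_mul_of_nonneg_left (Real.exp_le_exp.2 ?_) stdPDF_zero_pos.le
    nlinarith

/-- Reverse Jensen inequality for the Gaussian isoperimetric profile, for quantiles above the
median. -/
theorem stdPDF_le_mul_integral_of_nonneg {α : Type*} [MeasurableSpace α] (μ : Measure α)
    [IsProbabilityMeasure μ] {s : α → ℝ} (hs : Measurable s) {b w m : ℝ} (hw : 0 ≤ w)
    (hb : ∀ᵐ y ∂μ, b ≤ s y) (hbw : ∀ᵐ y ∂μ, s y ≤ b + w) (hm : 0 ≤ m)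
    (hsm : ∫ y, stdCDF (s y) ∂μ = stdCDF m) :
    stdPDF m ≤ 9 * (1 + w) * Real.exp (w ^ 2 / 8) * ∫ y, stdPDF (s y) ∂μ := by
  set J := ∫ y, stdPDF (s y) ∂μ with hJ
  have hIφ := integrable_stdPDF_comp μ hs
  have hIΦ := integrable_stdCDF_comp μ hs
  have hIΨ : Integrable (fun y => 1 - stdCDF (s y)) μ := (integrable_const 1).sub hIΦ
  have hΨ : ∫ y, (1 - stdCDF (s y)) ∂μ = 1 - stdCDF m := by
    rw [integral_sub (integrable_const 1) hIΦ, hsm]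
    simp
  have hmb : m ≤ b + w := by
    have h : ∫ y, stdCDF (s y) ∂μ ≤ ∫ _, stdCDF (b + w) ∂μ :=
      integral_mono_ae hIΦ (integrable_const _) (hbw.mono fun y hy =>
        strictMono_stdCDF.monotone hy)
    rw [hsm] at h
    simpa [strictMono_stdCDF.le_iff_le] using h
  have htail : ∀ κ : ℝ, (∀ᵐ y ∂μ, κ * (1 - stdCDF (s y)) ≤ stdPDF (s y)) →
      κ * (1 - stdCDF m) ≤ J := fun κ h => by
    rw [← hΨ, ← integral_const_mul]
    exact integral_mono_ae (hIΨ.const_mul κ) hIφ h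
  have he := Real.exp_one_lt_d9
  have hexp1 : 1 ≤ Real.exp (w ^ 2 / 8) := Real.one_le_exp (by positivity)
  have hexpneg : Real.exp (w ^ 2 / 8) * Real.exp (-w ^ 2 / 8) = 1 := by
    rw [← Real.exp_add, neg_div, add_neg_cancel, Real.exp_zero]
  have hΨm : 0 < 1 - stdCDF m := sub_pos.2 (stdCDF_lt_one m)
  have hmills := stdPDF_le_mul_one_sub_stdCDF hm
  have hφ0 := third_le_stdPDF_zero
  have hJ0 : 0 ≤ J := integral_nonneg fun y => (stdPDF_pos _).le
  -- If all quantiles are nonnegative, their hazard rates are at least `max b (1 / 2)`, comparable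
  -- to `m + 1` up to `3 * (1 + w)`. No exponential loss occurs.
  rcases le_or_gt 0 b with h0 | h0
  · have h1 := htail (max b (1 / 2)) (hb.mono fun y hy => max_mul_one_sub_stdCDF_le h0 hy)
    have h2 : m + 1 ≤ 3 * (1 + w) * max b (1 / 2) := by
      have := le_max_left b (1 / 2)
      have := le_max_right b (1 / 2)
      nlinarith
    calc stdPDF m ≤ Real.exp 1 * (m + 1) * (1 - stdCDF m) := hmills
      _ ≤ 3 * (3 * (1 + w) * max b (1 / 2)) * (1 - stdCDF m) := by
        gcongr
        linarith
      _ = 9 * (1 + w) * 1 * (max b (1 / 2) * (1 - stdCDF m)) := by ring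
      _ ≤ _ := by gcongr
  · have hbw0 : 0 ≤ b + w := hm.trans hmb
    have hexp0 := Real.exp_pos (-w ^ 2 / 8)
    -- The interval contains `0`, so its nearer endpoint is within `w / 2` of it, whence `exp (w ^ 2
    -- / 8)`. With the left end nearer, compare `φ` with the upper tail; with the right end nearer,
    -- compare it with `Φ`, whose average is at least `1 / 2`.
    rcases le_total (-b) (w / 2) with h1 | h1
    · have h2 := htail (stdPDF 0 * Real.exp (-w ^ 2 / 8)) <| hb.mono fun y hy =>
        mul_one_sub_stdCDF_le_of_neg_le hw (by linarith)
      calc stdPDF m ≤ Real.exp 1 * (m + 1) * (1 - stdCDF m) := hmills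
        _ ≤ 3 * (1 + w) * (1 - stdCDF m) := by
          exact mul_le_mul_of_nonneg_right (mul_le_mul (by linarith) (by linarith)
            (by linarith) (by norm_num)) hΨm.le
        _ = 3 * (1 + w) * (Real.exp (w ^ 2 / 8) * Real.exp (-w ^ 2 / 8)) * (1 - stdCDF m) := by
          rw [hexpneg, mul_one]
        _ = 9 * (1 + w) * Real.exp (w ^ 2 / 8) *
            (1 / 3 * Real.exp (-w ^ 2 / 8) * (1 - stdCDF m)) := by ring
        _ ≤ 9 * (1 + w) * Real.exp (w ^ 2 / 8) *
            (stdPDF 0 * Real.exp (-w ^ 2 / 8) * (1 - stdCDF m)) := by gcongr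
        _ ≤ _ := by gcongr
    · have h2 : stdPDF 0 * Real.exp (-w ^ 2 / 8) * stdCDF m ≤ J := by
        rw [← hsm, ← integral_const_mul]
        refine integral_mono_ae (hIΦ.const_mul _) hIφ ?_
        filter_upwards [hbw] with y hy
        have := mul_one_sub_stdCDF_le_of_neg_le (x := -s y) hw (by linarith)
        rwa [stdCDF_neg, sub_sub_cancel, stdPDF_neg] at this
      have h3 := half_le_stdCDF hm
      calc stdPDF m ≤ stdPDF 0 := stdPDF_le_zero m
        _ = 2 * (Real.exp (w ^ 2 / 8) * (stdPDF 0 * Real.exp (-w ^ 2 / 8) * (1 / 2))) := by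
          linear_combination (-stdPDF 0) * hexpneg
        _ ≤ 2 * (Real.exp (w ^ 2 / 8) * J) := by
          gcongr
          exact (mul_le_mul_of_nonneg_left h3 (by positivity)).trans h2
        _ ≤ _ := by
          have : 0 ≤ Real.exp (w ^ 2 / 8) * J := by positivity
          nlinarith [mul_nonneg hw this]

/-- Reverse Jensen inequality for the Gaussian isoperimetric profile: it loses at most the factor
`9 * (1 + w) * exp (w ^ 2 / 8)` on an interval of length `w`. -/
theorem stdPDF_le_mul_integral {α : Type*} [MeasurableSpace α] (μ : Measure α)
    [IsProbabilityMeasure μ] {s : α → ℝ} (hs : Measurable s) {b w m : ℝ} (hw : 0 ≤ w)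
    (hb : ∀ᵐ y ∂μ, b ≤ s y) (hbw : ∀ᵐ y ∂μ, s y ≤ b + w)
    (hsm : ∫ y, stdCDF (s y) ∂μ = stdCDF m) :
    stdPDF m ≤ 9 * (1 + w) * Real.exp (w ^ 2 / 8) * ∫ y, stdPDF (s y) ∂μ := by
  rcases le_total 0 m with hm | hm
  · exact stdPDF_le_mul_integral_of_nonneg μ hs hw hb hbw hm hsm
  · have h := stdPDF_le_mul_integral_of_nonneg μ (s := fun y => -s y) (b := -(b + w)) (m := -m)
      hs.neg hw (hbw.mono fun y hy => neg_le_neg hy) (hb.mono fun y hy => by linarith)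
      (neg_nonneg.2 hm) (by
        simp_rw [stdCDF_neg]
        rw [integral_sub (integrable_const 1) (integrable_stdCDF_comp μ hs), hsm]
        simp)
    simpa only [stdPDF_neg] using h

/-! ### From densities to test functions -/

/-- The measure with density `p`. -/
def densityMeasure (p : ℝ → ℝ) : Measure ℝ := volume.withDensity fun x => ENNReal.ofReal (p x)

namespace IsPosDensity

variable {p : ℝ → ℝ}

theorem measurable_ofReal (hp : IsPosDensity p) : Measurable fun x => ENNReal.ofReal (p x) :=
  hp.continuous.measurable.ennreal_ofReal

theorem isProbabilityMeasure (hp : IsPosDensity p) : IsProbabilityMeasure (densityMeasure p) := by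
  constructor
  rw [densityMeasure, withDensity_apply _ MeasurableSet.univ, Measure.restrict_univ,
    ← ofReal_integral_eq_lintegral_ofReal hp.integrable (ae_of_all _ fun x => (hp.pos x).le),
    hp.integral_eq_one, ENNReal.ofReal_one]

theorem integral_densityMeasure (hp : IsPosDensity p) (h : ℝ → ℝ) :
    ∫ x, h x ∂densityMeasure p = ∫ x, h x * p x := by
  rw [densityMeasure, integral_withDensity_eq_integral_toReal_smul hp.measurable_ofReal
    (ae_of_all _ fun x => ENNReal.ofReal_lt_top)]
  refine integral_congr_ae (ae_of_all _ fun x => ?_)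
  simp [ENNReal.toReal_ofReal (hp.pos x).le, mul_comm]

theorem integrable_densityMeasure_iff (hp : IsPosDensity p) (h : ℝ → ℝ) :
    Integrable h (densityMeasure p) ↔ Integrable fun x => h x * p x := by
  rw [densityMeasure, integrable_withDensity_iff hp.measurable_ofReal
    (ae_of_all _ fun x => ENNReal.ofReal_lt_top)]
  simp_rw [ENNReal.toReal_ofReal (hp.pos _).le]

end IsPosDensity

theorem ae_differentiableAt_of_absolutelyContinuousOnInterval {f : ℝ → ℝ}
    (hf : ∀ a b, AbsolutelyContinuousOnInterval f a b) : ∀ᵐ x, DifferentiableAt ℝ f x := by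
  have h : ∀ᵐ x, ∀ n : ℕ, x ∈ uIcc (-n : ℝ) n → DifferentiableAt ℝ f x :=
    ae_all_iff.2 fun n => (hf (-n) n).ae_differentiableAt
  filter_upwards [h] with x hx
  obtain ⟨n, hn⟩ := exists_nat_ge |x|
  refine hx n ?_
  rw [uIcc_of_le (by linarith [abs_nonneg x])]
  exact abs_le.1 hn

/-- The entropy bound for functions bounded above and away from zero. -/
theorem integral_sq_mul_log_le {p f : ℝ → ℝ} {L ε M : ℝ} (hp : IsPosDensity p)
    (hL : ∀ x y, stdCDF y = densityCDF p x → stdPDF y ≤ L * p x)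
    (hf : ∀ a b, AbsolutelyContinuousOnInterval f a b) (hε : 0 < ε) (hεf : ∀ x, ε ≤ f x)
    (hfM : ∀ x, f x ≤ M) (hint : Integrable (fun x => deriv f x ^ 2) (densityMeasure p)) :
    ∫ x, f x ^ 2 * Real.log (f x ^ 2 / ∫ y, f y ^ 2 ∂densityMeasure p) ∂densityMeasure p
      ≤ 2 * L ^ 2 * ∫ x, deriv f x ^ 2 ∂densityMeasure p := by
  have := hp.isProbabilityMeasure
  have hf0 : ∀ x, 0 < f x := fun x => hε.trans_le (hεf x)
  have hfc := continuous_of_absolutelyContinuousOnInterval hf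
  have hf2 : Integrable (fun x => f x ^ 2) (densityMeasure p) :=
    Integrable.of_bound (hfc.pow 2).aestronglyMeasurable (M ^ 2) (ae_of_all _ fun x => by
      rw [Real.norm_of_nonneg (sq_nonneg _)]
      exact pow_le_pow_left₀ (hf0 x).le (hfM x) 2)
  set Z := ∫ y, f y ^ 2 ∂densityMeasure p with hZ
  have hZ0 : 0 < Z := by
    have h : ∫ _, ε ^ 2 ∂densityMeasure p ≤ Z :=
      integral_mono (integrable_const _) hf2 fun x => pow_le_pow_left₀ hε.le (hεf x) 2
    have h2 : 0 < ε ^ 2 := by positivity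
    simp only [integral_const, probReal_univ, smul_eq_mul, one_mul] at h
    linarith
  set g : ℝ → ℝ := fun x => Z⁻¹ * (f x * f x) with hg
  have hgf : ∀ x, g x = f x ^ 2 / Z := fun x => by rw [hg]; ring
  have hgac : ∀ a b, AbsolutelyContinuousOnInterval g a b := fun a b =>
    ((hf a b).mul (hf a b)).const_mul Z⁻¹
  have hfd := ae_differentiableAt_of_absolutelyContinuousOnInterval hf
  -- For `g = f ^ 2 / Z` one has `g' ^ 2 / g = 4 * f' ^ 2 / Z`, which turns `L ^ 2 / 2` into `2 * L
  -- ^ 2`.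
  have hfisher : (fun x => deriv g x ^ 2 / g x * p x) =ᵐ[volume]
      fun x => 4 / Z * (deriv f x ^ 2 * p x) := by
    filter_upwards [hfd] with x hx
    have hgd : deriv g x = Z⁻¹ * (deriv f x * f x + f x * deriv f x) :=
      ((hx.hasDerivAt.mul hx.hasDerivAt).const_mul Z⁻¹).deriv
    have := (hf0 x).ne'
    rw [hgd, hgf]
    field_simp
    ring
  have hint' := (hp.integrable_densityMeasure_iff _).1 hint
  have key := integral_mul_log_le (g := g) (c := ε ^ 2 / Z) (C := M ^ 2 / Z) hp hL hgac
    (by positivity)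
    (fun x => by rw [hgf]; gcongr; exact hεf x)
    (fun x => by rw [hgf]; gcongr; exacts [(hf0 x).le, hfM x])
    (by
      simp_rw [hgf, div_mul_eq_mul_div]
      rw [integral_div, ← hp.integral_densityMeasure (fun x => f x ^ 2), ← hZ, div_self hZ0.ne'])
    ((hint'.const_mul (4 / Z)).congr hfisher.symm)
  rw [integral_congr_ae hfisher, integral_const_mul, ← hp.integral_densityMeasure,
    ← hp.integral_densityMeasure] at key
  have h1 : ∫ x, f x ^ 2 * Real.log (f x ^ 2 / Z) ∂densityMeasure p
      = Z * ∫ x, g x * Real.log (g x) ∂densityMeasure p := by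
    rw [← integral_const_mul]
    refine integral_congr_ae (ae_of_all _ fun x => ?_)
    simp only [hgf]
    field_simp
  rw [h1]
  calc Z * ∫ x, g x * Real.log (g x) ∂densityMeasure p
      ≤ Z * (L ^ 2 / 2 * (4 / Z * ∫ x, deriv f x ^ 2 ∂densityMeasure p)) := by gcongr
    _ = _ := by field_simp; ring

/-! ### Truncation -/

/-- Truncation of a function to the interval `[1 / (n + 1), n + 1]`. -/
def truncate (f : ℝ → ℝ) (n : ℕ) (x : ℝ) : ℝ := max (1 / ((n : ℝ) + 1)) (min (f x) (n + 1))

/-- Clamping to an interval is a contraction; both absolute continuity and the derivative bound for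
truncations come from this. -/
theorem dist_truncate_le (f : ℝ → ℝ) (n : ℕ) (x y : ℝ) :
    dist (truncate f n x) (truncate f n y) ≤ dist (f x) (f y) := by
  simp only [truncate, Real.dist_eq]
  calc _ ≤ |min (f x) (n + 1) - min (f y) (n + 1)| := by
        simpa using abs_max_sub_max_le_max (1 / ((n : ℝ) + 1)) (min (f x) (n + 1))
          (1 / ((n : ℝ) + 1)) (min (f y) (n + 1))
    _ ≤ _ := by
        simpa using abs_min_sub_min_le_max (f x) ((n : ℝ) + 1) (f y) ((n : ℝ) + 1)

theorem absolutelyContinuousOnInterval_truncate {f : ℝ → ℝ} {a b : ℝ}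
    (hf : AbsolutelyContinuousOnInterval f a b) (n : ℕ) :
    AbsolutelyContinuousOnInterval (truncate f n) a b := by
  rw [absolutelyContinuousOnInterval_iff] at hf ⊢
  intro ε hε
  obtain ⟨δ, hδ, h⟩ := hf ε hε
  exact ⟨δ, hδ, fun E hE hEδ => (Finset.sum_le_sum fun i _ => dist_truncate_le f n _ _).trans_lt
    (h E hE hEδ)⟩

theorem sq_deriv_truncate_le {f : ℝ → ℝ} {x : ℝ} (n : ℕ) (hf : DifferentiableAt ℝ f x) :
    deriv (truncate f n) x ^ 2 ≤ deriv f x ^ 2 := by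
  by_cases h : DifferentiableAt ℝ (truncate f n) x
  · have h1 := h.hasDerivAt.tendsto_slope.norm
    have h2 := hf.hasDerivAt.tendsto_slope.norm
    have h3 : ‖deriv (truncate f n) x‖ ≤ ‖deriv f x‖ :=
      le_of_tendsto_of_tendsto' h1 h2 fun y => by
        rw [slope_def_field, slope_def_field, norm_div, norm_div]
        exact div_le_div_of_nonneg_right
          (by simpa [dist_eq_norm] using dist_truncate_le f n y x) (norm_nonneg _)
    exact sq_le_sq.2 h3
  -- At a corner created by truncation `deriv` takes its default value `0`.
  · rw [deriv_zero_of_not_differentiableAt h]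
    simpa using sq_nonneg (deriv f x)

theorem one_div_le_truncate (f : ℝ → ℝ) (n : ℕ) (x : ℝ) : 1 / ((n : ℝ) + 1) ≤ truncate f n x :=
  le_max_left _ _

theorem truncate_pos (f : ℝ → ℝ) (n : ℕ) (x : ℝ) : 0 < truncate f n x :=
  (by positivity : (0 : ℝ) < 1 / ((n : ℝ) + 1)).trans_le (one_div_le_truncate f n x)

theorem truncate_le (f : ℝ → ℝ) (n : ℕ) (x : ℝ) : truncate f n x ≤ n + 1 := by
  refine max_le ?_ (min_le_right _ _)
  have h : (1 : ℝ) ≤ n + 1 := by linarith [Nat.cast_nonneg (α := ℝ) n]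
  exact (div_le_one₀ (by linarith)).2 h |>.trans h

theorem truncate_sq_le {f : ℝ → ℝ} (n : ℕ) {x : ℝ} (hf : 0 ≤ f x) :
    truncate f n x ^ 2 ≤ f x ^ 2 + 1 := by
  have h : (1 : ℝ) / (n + 1) ≤ 1 :=
    (div_le_one₀ (by positivity)).2 (by linarith [Nat.cast_nonneg (α := ℝ) n])
  have h1 : truncate f n x ≤ max 1 (f x) := max_le_max h (min_le_left _ _)
  have h2 := truncate_pos f n x
  rcases max_cases 1 (f x) with h3 | h3 <;> rw [h3.1] at h1 <;> nlinarith

theorem tendsto_truncate {f : ℝ → ℝ} {x : ℝ} (hf : 0 ≤ f x) :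
    Tendsto (fun n => truncate f n x) atTop (𝓝 (f x)) := by
  have h1 : Tendsto (fun n : ℕ => min (f x) ((n : ℝ) + 1)) atTop (𝓝 (f x)) := by
    refine tendsto_const_nhds.congr' ?_
    filter_upwards [eventually_ge_atTop ⌈f x⌉₊] with n hn
    rw [min_eq_left]
    linarith [Nat.ceil_le.1 hn]
  have h2 := (tendsto_one_div_add_atTop_nhds_zero_nat (𝕜 := ℝ)).max h1
  rwa [max_eq_right hf] at h2

/-! ### Passage to the limit in the entropy -/

/-- A form of `log u ≥ 1 - 1 / u`. Adding `c - t` makes the entropy integrand nonnegative, as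
Fatou's lemma requires, without changing its integral when `c` is the mass. -/
theorem mul_log_div_nonneg {t c : ℝ} (ht : 0 ≤ t) (hc : 0 < c) :
    0 ≤ t * Real.log (t / c) - t + c := by
  rcases ht.eq_or_lt with rfl | ht
  · simpa using hc.le
  have h := Real.one_sub_inv_le_log_of_pos (div_pos ht hc)
  rw [inv_div] at h
  have h2 := mul_le_mul_of_nonneg_left h ht.le
  have h3 : t * (1 - c / t) = t - c := by field_simp
  linarith

theorem integrable_mul_log_div {ν : Measure ℝ} [IsFiniteMeasure ν] {h : ℝ → ℝ} {m M c : ℝ}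
    (hh : Measurable h) (hm : 0 < m) (hc : 0 < c) (hmh : ∀ x, m ≤ h x) (hhM : ∀ x, h x ≤ M) :
    Integrable (fun x => h x * Real.log (h x / c)) ν := by
  refine Integrable.of_bound
    (hh.mul (Real.measurable_log.comp (hh.div_const c))).aestronglyMeasurable
    (M * max |Real.log (m / c)| |Real.log (M / c)|) (ae_of_all _ fun x => ?_)
  have hx : 0 < h x := hm.trans_le (hmh x)
  rw [norm_mul, Real.norm_of_nonneg hx.le]
  refine mul_le_mul (hhM x) ?_ (norm_nonneg _) (hx.le.trans (hhM x))
  exact abs_le_max_abs_abs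
    (Real.log_le_log (div_pos hm hc) (div_le_div_of_nonneg_right (hmh x) hc.le))
    (Real.log_le_log (div_pos hx hc) (div_le_div_of_nonneg_right (hhM x) hc.le))

/-- Lower semicontinuity of the entropy under pointwise convergence with convergence of the
masses. -/
theorem integrable_and_integral_mul_log_le_of_tendsto {ν : Measure ℝ} [IsProbabilityMeasure ν]
    {h : ℝ → ℝ} {hn : ℕ → ℝ → ℝ} {B : ℝ} (hB : 0 ≤ B) (hm : Measurable h)
    (hnm : ∀ n, Measurable (hn n)) (h0 : ∀ x, 0 ≤ h x) (hn0 : ∀ n x, 0 ≤ hn n x)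
    (hi : Integrable h ν) (hni : ∀ n, Integrable (hn n) ν) (hZ0 : 0 < ∫ x, h x ∂ν)
    (hc0 : ∀ n, 0 < ∫ x, hn n x ∂ν)
    (hlim : ∀ x, Tendsto (fun n => hn n x) atTop (𝓝 (h x)))
    (hclim : Tendsto (fun n => ∫ x, hn n x ∂ν) atTop (𝓝 (∫ x, h x ∂ν)))
    (hlogint : ∀ n, Integrable (fun x => hn n x * Real.log (hn n x / ∫ y, hn n y ∂ν)) ν)
    (hbound : ∀ n, ∫ x, hn n x * Real.log (hn n x / ∫ y, hn n y ∂ν) ∂ν ≤ B) :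
    Integrable (fun x => h x * Real.log (h x / ∫ y, h y ∂ν)) ν ∧
      ∫ x, h x * Real.log (h x / ∫ y, h y ∂ν) ∂ν ≤ B := by
  obtain ⟨Z, hZ⟩ : ∃ Z, Z = ∫ x, h x ∂ν := ⟨_, rfl⟩
  obtain ⟨c, hc⟩ : ∃ c : ℕ → ℝ, ∀ n, c n = ∫ x, hn n x ∂ν := ⟨_, fun _ => rfl⟩
  simp only [← hZ, ← hc] at hZ0 hc0 hclim hlogint hbound ⊢
  set en : ℕ → ℝ → ℝ := fun n x => hn n x * Real.log (hn n x / c n) - hn n x + c n with hen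
  have hen0 : ∀ n x, 0 ≤ en n x := fun n x => mul_log_div_nonneg (hn0 n x) (hc0 n)
  have henm : ∀ n, Measurable (en n) := fun n =>
    (((hnm n).mul (Real.measurable_log.comp ((hnm n).div_const (c n)))).sub (hnm n)).add_const _
  have heni : ∀ n, Integrable (en n) ν := fun n =>
    ((hlogint n).sub (hni n)).add (integrable_const _)
  have henB : ∀ n, ∫ x, en n x ∂ν ≤ B := fun n => by
    have h1 : Integrable (fun x => hn n x * Real.log (hn n x / c n) - hn n x) ν :=
      (hlogint n).sub (hni n)
    have h2 : ∫ x, en n x ∂ν = ∫ x, hn n x * Real.log (hn n x / c n) ∂ν := by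
      simp only [hen]
      rw [integral_add h1 (integrable_const _), integral_sub (hlogint n) (hni n), ← hc]
      simp
    rw [h2]
    exact hbound n
  set e : ℝ → ℝ := fun x => h x * Real.log (h x / Z) - h x + Z with he
  have he0 : ∀ x, 0 ≤ e x := fun x => mul_log_div_nonneg (h0 x) hZ0
  have hem : Measurable e :=
    ((hm.mul (Real.measurable_log.comp (hm.div_const Z))).sub hm).add_const Z
  have hptw : ∀ x, Tendsto (fun n => en n x) atTop (𝓝 (e x)) := fun x => by
    have h2 := (hlim x).div hclim hZ0.ne'
    -- The logarithm is discontinuous where `h x = 0`, so the continuous function `u * log u` is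
    -- applied to `u = hn n x / c n` and the factor `c n` is restored afterwards.
    have h3 := ((Real.continuous_mul_log.tendsto _).comp h2).mul hclim
    have h5 : ∀ t s l : ℝ, s ≠ 0 → t / s * l * s = t * l := fun t s l hs => by field_simp
    rw [h5 _ _ _ hZ0.ne'] at h3
    have h4 : Tendsto (fun n => hn n x * Real.log (hn n x / c n)) atTop
        (𝓝 (h x * Real.log (h x / Z))) :=
      h3.congr fun n => h5 _ _ _ (hc0 n).ne'
    exact (h4.sub (hlim x)).add hclim
  have hlint : ∫⁻ x, ENNReal.ofReal (e x) ∂ν ≤ ENNReal.ofReal B := by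
    have h1 : ∀ x, liminf (fun n => ENNReal.ofReal (en n x)) atTop = ENNReal.ofReal (e x) :=
      fun x => ((ENNReal.continuous_ofReal.tendsto _).comp (hptw x)).liminf_eq
    calc ∫⁻ x, ENNReal.ofReal (e x) ∂ν
        = ∫⁻ x, liminf (fun n => ENNReal.ofReal (en n x)) atTop ∂ν := (lintegral_congr h1).symm
      _ ≤ liminf (fun n => ∫⁻ x, ENNReal.ofReal (en n x) ∂ν) atTop :=
        lintegral_liminf_le fun n => (henm n).ennreal_ofReal
      _ ≤ ENNReal.ofReal B := by
        refine liminf_le_of_frequently_le' (Frequently.of_forall fun n => ?_)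
        rw [← ofReal_integral_eq_lintegral_ofReal (heni n) (ae_of_all _ (hen0 n))]
        exact ENNReal.ofReal_le_ofReal (henB n)
  have heint : Integrable e ν := by
    refine ⟨hem.aestronglyMeasurable, ?_⟩
    rw [hasFiniteIntegral_iff_ofReal (ae_of_all _ he0)]
    exact hlint.trans_lt ENNReal.ofReal_lt_top
  have hele : ∫ x, e x ∂ν ≤ B := by
    rw [← ofReal_integral_eq_lintegral_ofReal heint (ae_of_all _ he0)] at hlint
    exact (ENNReal.ofReal_le_ofReal_iff hB).1 hlint
  have heq : (fun x => h x * Real.log (h x / Z)) = fun x => e x + h x - Z := by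
    ext x
    rw [he]
    ring
  rw [heq]
  have hsum : Integrable (fun x => e x + h x) ν := heint.add hi
  refine ⟨hsum.sub (integrable_const _), ?_⟩
  rw [integral_sub hsum (integrable_const _), integral_add heint hi, ← hZ]
  simpa using hele

/-- A measure whose density `p` dominates the Gaussian isoperimetric profile satisfies a
logarithmic Sobolev inequality. -/
theorem satisfiesLSI_densityMeasure {p : ℝ → ℝ} {L : ℝ} (hp : IsPosDensity p)
    (hL : ∀ x y, stdCDF y = densityCDF p x → stdPDF y ≤ L * p x) :
    SatisfiesLSI (densityMeasure p) (2 * L ^ 2) := by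
  intro f hf
  have := hp.isProbabilityMeasure
  have hfc := continuous_of_absolutelyContinuousOnInterval hf.absolutelyContinuous
  have hf2 : Integrable (fun x => f x ^ 2) (densityMeasure p) := hf.memLp.integrable_sq
  have hE : Integrable (fun x => deriv f x ^ 2) (densityMeasure p) := hf.memLp_deriv.integrable_sq
  have hE0 : 0 ≤ 2 * L ^ 2 * energy (densityMeasure p) f :=
    mul_nonneg (by positivity) (integral_nonneg fun x => sq_nonneg _)
  rcases (integral_nonneg fun x => sq_nonneg (f x) :
      0 ≤ ∫ x, f x ^ 2 ∂densityMeasure p).eq_or_lt with hZ0 | hZ0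
  -- With zero mass, division by zero and then `Real.log 0 = 0` make the integrand vanish.
  · have h0 : entropyIntegrand (densityMeasure p) (fun x => f x ^ 2) = fun _ => 0 := by
      ext x
      simp [entropyIntegrand, ← hZ0]
    rw [entropy, h0, integral_zero]
    exact ⟨integrable_zero _ _ _, hE0⟩
  have hac : ∀ n a b, AbsolutelyContinuousOnInterval (truncate f n) a b := fun n a b =>
    absolutelyContinuousOnInterval_truncate (hf.absolutelyContinuous a b) n
  have hc : ∀ n, Continuous (truncate f n) := fun n =>
    continuous_of_absolutelyContinuousOnInterval (hac n)
  have hle : ∀ n, ∀ᵐ x ∂densityMeasure p, ‖truncate f n x ^ 2‖ ≤ f x ^ 2 + 1 := fun n =>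
    ae_of_all _ fun x => by
      rw [Real.norm_of_nonneg (sq_nonneg _)]
      exact truncate_sq_le n (hf.nonneg x)
  have hf21 : Integrable (fun x => f x ^ 2 + (1 : ℝ)) (densityMeasure p) :=
    hf2.add (integrable_const (1 : ℝ))
  have h2 : ∀ n, Integrable (fun x => truncate f n x ^ 2) (densityMeasure p) := fun n =>
    hf21.mono' ((hc n).pow 2).aestronglyMeasurable (hle n)
  have hlow : ∀ (n : ℕ) x, (1 / ((n : ℝ) + 1)) ^ 2 ≤ truncate f n x ^ 2 := fun n x =>
    pow_le_pow_left₀ (by positivity) (one_div_le_truncate f n x) 2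
  have hc0 : ∀ n, 0 < ∫ x, truncate f n x ^ 2 ∂densityMeasure p := fun n => by
    have h := integral_mono (integrable_const _) (h2 n) (hlow n)
    simp only [integral_const, probReal_univ, smul_eq_mul, one_mul] at h
    exact lt_of_lt_of_le (by positivity) h
  have hEn : ∀ n, Integrable (fun x => deriv (truncate f n) x ^ 2) (densityMeasure p) := fun n =>
    hE.mono' ((measurable_deriv _).pow_const 2).aestronglyMeasurable
      (hf.differentiable.mono fun x hx => by
        rw [Real.norm_of_nonneg (sq_nonneg _)]
        exact sq_deriv_truncate_le n hx)
  have hup : ∀ (n : ℕ) x, truncate f n x ^ 2 ≤ ((n : ℝ) + 1) ^ 2 := fun n x =>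
    pow_le_pow_left₀ (truncate_pos f n x).le (truncate_le f n x) 2
  have hlow0 : ∀ n : ℕ, 0 < (1 / ((n : ℝ) + 1)) ^ 2 := fun n => by positivity
  refine integrable_and_integral_mul_log_le_of_tendsto (h := fun x => f x ^ 2)
    (hn := fun n x => truncate f n x ^ 2) hE0
    (hfc.pow 2).measurable (fun n => ((hc n).pow 2).measurable) (fun x => sq_nonneg _)
    (fun n x => sq_nonneg _) hf2 h2 hZ0 hc0
    (fun x => (tendsto_truncate (hf.nonneg x)).pow 2) ?_ ?_ ?_
  · exact tendsto_integral_of_dominated_convergence (fun x => f x ^ 2 + 1)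
      (fun n => ((hc n).pow 2).aestronglyMeasurable) hf21 hle
      (ae_of_all _ fun x => (tendsto_truncate (hf.nonneg x)).pow 2)
  · exact fun n => integrable_mul_log_div (h := fun x => truncate f n x ^ 2)
      ((hc n).pow 2).measurable (hlow0 n) (hc0 n) (hlow n) (hup n)
  · intro n
    refine (integral_sq_mul_log_le hp hL (hac n) (by positivity) (one_div_le_truncate f n)
      (truncate_le f n) (hEn n)).trans (mul_le_mul_of_nonneg_left ?_ (by positivity))
    simp only [energy, sq_abs]
    exact integral_mono_ae (hEn n) hE
      (hf.differentiable.mono fun x hx => sq_deriv_truncate_le n hx)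

/-! ### Gaussian mollification -/

/-- The density of the convolution of `μ` with the centred Gaussian of standard deviation `σ`. -/
def mollifiedDensity (μ : Measure ℝ) (σ x : ℝ) : ℝ := σ⁻¹ * ∫ y, stdPDF ((x - y) / σ) ∂μ

theorem gaussianPDFReal_sq_eq {σ : ℝ} (hσ : 0 < σ) (m x : ℝ) :
    gaussianPDFReal m (σ ^ 2).toNNReal x = σ⁻¹ * stdPDF ((x - m) / σ) := by
  rw [stdPDF_eq, gaussianPDFReal, Real.coe_toNNReal _ (sq_nonneg σ),
    Real.sqrt_mul (by positivity), Real.sqrt_sq hσ.le, div_pow, mul_inv, ← mul_assoc,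
    mul_comm σ⁻¹]
  congr 2
  field_simp

section

variable (μ : Measure ℝ) [IsProbabilityMeasure μ] {σ : ℝ}

theorem continuous_mollifiedDensity : Continuous (mollifiedDensity μ σ) := by
  refine continuous_const.mul (continuous_of_dominated (bound := fun _ => stdPDF 0) ?_ ?_ ?_ ?_)
  · exact fun x => (integrable_stdPDF_comp μ (by fun_prop)).aestronglyMeasurable
  · exact fun x => ae_of_all _ fun y => by
      rw [Real.norm_of_nonneg (stdPDF_pos _).le]
      exact stdPDF_le_zero _
  · exact integrable_const _
  · exact ae_of_all _ fun y => continuous_stdPDF.comp (by fun_prop)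

theorem mollifiedDensity_pos (hσ : 0 < σ) (x : ℝ) : 0 < mollifiedDensity μ σ x := by
  refine mul_pos (inv_pos.2 hσ) ?_
  rw [integral_pos_iff_support_of_nonneg (fun y => (stdPDF_pos _).le)
    (integrable_stdPDF_comp μ (by fun_prop))]
  have : Function.support (fun y => stdPDF ((x - y) / σ)) = univ :=
    eq_univ_of_forall fun y => (stdPDF_pos _).ne'
  rw [this]
  simp

theorem ofReal_mollifiedDensity (hσ : 0 < σ) (x : ℝ) :
    ENNReal.ofReal (mollifiedDensity μ σ x)
      = ∫⁻ y, gaussianPDF y (σ ^ 2).toNNReal x ∂μ := by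
  rw [mollifiedDensity, ← integral_const_mul, ofReal_integral_eq_lintegral_ofReal
    ((integrable_stdPDF_comp μ (by fun_prop)).const_mul _)
    (ae_of_all _ fun y => mul_nonneg (inv_pos.2 hσ).le (stdPDF_pos _).le)]
  simp_rw [gaussianPDF, gaussianPDFReal_sq_eq hσ]

/-- The convolution with a Gaussian has the mollified density. -/
theorem conv_gaussianReal_eq (hσ : 0 < σ) :
    μ.conv (gaussianReal 0 (σ ^ 2).toNNReal) = densityMeasure (mollifiedDensity μ σ) := by
  have hv : (σ ^ 2).toNNReal ≠ 0 := (Real.toNNReal_pos.2 (by positivity)).ne'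
  ext s hs
  rw [Measure.conv, Measure.map_apply (by fun_prop) hs,
    Measure.prod_apply (measurable_add hs), densityMeasure, withDensity_apply _ hs]
  simp_rw [ofReal_mollifiedDensity μ hσ]
  rw [lintegral_lintegral_swap]
  · refine lintegral_congr fun y => ?_
    rw [← gaussianReal_apply y hv, ← zero_add y, ← gaussianReal_map_const_add y,
      Measure.map_apply (by fun_prop) hs]
    simp
    rfl
  · exact (measurable_uncurry_gaussianPDF.comp
      (f := fun z : ℝ × ℝ => (z.2, (σ ^ 2).toNNReal, z.1)) (by fun_prop)).aemeasurable

theorem isPosDensity_mollifiedDensity (hσ : 0 < σ) : IsPosDensity (mollifiedDensity μ σ) := by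
  have hprob : ∫⁻ x, ENNReal.ofReal (mollifiedDensity μ σ x) = 1 := by
    have h : μ.conv (gaussianReal 0 (σ ^ 2).toNNReal) univ = 1 := measure_univ
    rwa [conv_gaussianReal_eq μ hσ, densityMeasure, withDensity_apply _ MeasurableSet.univ,
      Measure.restrict_univ] at h
  have hnn : 0 ≤ᵐ[volume] mollifiedDensity μ σ :=
    ae_of_all _ fun x => (mollifiedDensity_pos μ hσ x).le
  have hm := (continuous_mollifiedDensity μ (σ := σ)).aestronglyMeasurable (μ := volume)
  refine ⟨continuous_mollifiedDensity μ, mollifiedDensity_pos μ hσ, ⟨hm, ?_⟩, ?_⟩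
  · rw [hasFiniteIntegral_iff_ofReal hnn, hprob]
    exact ENNReal.one_lt_top
  · rw [integral_eq_lintegral_of_nonneg_ae hnn hm, hprob, ENNReal.toReal_one]

/-- By Tonelli's theorem, since a Gaussian centred at `y` gives mass `Φ((x - y) / σ)` to `Iic x`.
This identifies `F(x)` with the average in the reverse Jensen inequality. -/
theorem densityCDF_mollifiedDensity (hσ : 0 < σ) (x : ℝ) :
    densityCDF (mollifiedDensity μ σ) x = ∫ y, stdCDF ((x - y) / σ) ∂μ := by
  have hp := isPosDensity_mollifiedDensity μ hσ
  have hv : (σ ^ 2).toNNReal ≠ 0 := (Real.toNNReal_pos.2 (by positivity)).ne'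
  have hcdf : ∀ y, ENNReal.ofReal (stdCDF ((x - y) / σ))
      = ∫⁻ t in Iic x, gaussianPDF y (σ ^ 2).toNNReal t := fun y => by
    have hstd : ENNReal.ofReal (stdCDF ((x - y) / σ)) = gaussianReal 0 1 (Iic ((x - y) / σ)) :=
      (gaussianReal_apply_eq_integral 0 one_ne_zero _).symm
    rw [← gaussianReal_apply y hv, hstd]
    have : gaussianReal y (σ ^ 2).toNNReal = (gaussianReal 0 1).map (fun t => y + σ * t) := by
      rw [← Function.comp_def (fun t => y + t) (fun t => σ * t),
        ← Measure.map_map (by fun_prop) (by fun_prop), gaussianReal_map_const_mul,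
        gaussianReal_map_const_add]
      congr 1
      · simp
      · ext
        simp [sq_nonneg]
    rw [this, Measure.map_apply (by fun_prop) measurableSet_Iic]
    congr 1
    ext t
    simp only [mem_Iic, mem_preimage, le_div_iff₀ hσ]
    constructor <;> intro h <;> linarith
  have h1 : ENNReal.ofReal (densityCDF (mollifiedDensity μ σ) x)
      = ENNReal.ofReal (∫ y, stdCDF ((x - y) / σ) ∂μ) := by
    rw [densityCDF, ofReal_integral_eq_lintegral_ofReal hp.integrable.integrableOn
      (ae_of_all _ fun t => (hp.pos t).le), ofReal_integral_eq_lintegral_ofReal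
      (integrable_stdCDF_comp μ (by fun_prop)) (ae_of_all _ fun y => (stdCDF_pos _).le)]
    simp_rw [ofReal_mollifiedDensity μ hσ, hcdf]
    rw [lintegral_lintegral_swap]
    exact (measurable_uncurry_gaussianPDF.comp
      (f := fun z : ℝ × ℝ => (z.2, (σ ^ 2).toNNReal, z.1)) (by fun_prop)).aemeasurable
  exact (ENNReal.ofReal_eq_ofReal_iff (hp.densityCDF_pos x).le
    (integral_nonneg fun y => (stdCDF_pos _).le)).1 h1

/-- The logarithmic Sobolev inequality for the mollification of a measure supported in an interval
of length `2 * R`. -/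
theorem satisfiesLSI_conv_gaussianReal {a R : ℝ} (hR : 0 ≤ R) (hσ : 0 < σ)
    (hμ : ∀ᵐ y ∂μ, y ∈ Icc a (a + 2 * R)) :
    SatisfiesLSI (μ.conv (gaussianReal 0 (σ ^ 2).toNNReal))
      (162 * (σ + 2 * R) ^ 2 * Real.exp (R ^ 2 / σ ^ 2)) := by
  have h := satisfiesLSI_densityMeasure
    -- The reverse Jensen factor for `w = 2 * R / σ`; the extra `σ` cancels the `σ⁻¹` in the
    -- density.
    (L := 9 * (1 + 2 * R / σ) * Real.exp ((2 * R / σ) ^ 2 / 8) * σ)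
    (isPosDensity_mollifiedDensity μ hσ) fun x m hm => by
      rw [densityCDF_mollifiedDensity μ hσ] at hm
      have := stdPDF_le_mul_integral μ (s := fun y => (x - y) / σ) (b := (x - (a + 2 * R)) / σ)
        (w := 2 * R / σ) (by fun_prop) (by positivity)
        (hμ.mono fun y hy => by gcongr; exact hy.2)
        (hμ.mono fun y hy => by
          rw [← add_div]
          gcongr
          linarith [hy.1]) hm.symm
      rw [mollifiedDensity]
      refine this.trans_eq ?_
      field_simp
  rw [conv_gaussianReal_eq μ hσ]
  convert h using 1
  rw [mul_pow, mul_pow, ← Real.exp_nat_mul]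
  have : ((2 : ℕ) : ℝ) * ((2 * R / σ) ^ 2 / 8) = R ^ 2 / σ ^ 2 := by
    field_simp
    ring
  rw [this]
  field_simp
  ring

end

/-! ### Comparison with the stated constants -/

theorem optimalConstant_le {ν : Measure ℝ} {c r : ℝ} (h : SatisfiesLSI ν c) (hcr : c ≤ r) :
    optimalConstant ν ≤ (r : EReal) :=
  (sInf_le (show (c : EReal) ∈ {c : EReal | ∃ r : ℝ, c = r ∧ SatisfiesLSI ν r} from
    ⟨c, rfl, h⟩)).trans (EReal.coe_le_coe hcr)

theorem sq_rpow_three_halves {σ : ℝ} (hσ : 0 < σ) : (σ ^ 2) ^ (3 / 2 : ℝ) = σ ^ 3 := by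
  rw [← Real.rpow_natCast σ 2, ← Real.rpow_mul hσ.le, ← Real.rpow_natCast σ 3]
  norm_num

end LogSobolev

end

theorem theorem2 (μ : Measure ℝ) [IsProbabilityMeasure μ] (a R δ : ℝ)
    (hμ : μ.support ⊆ Set.Icc a (a + 2 * R)) (hδ : 0 < δ) :
    LogSobolev.optimalConstant (Measure.conv μ (gaussianReal 0 δ.toNNReal)) ≤
        ((6905 * (δ ^ (3 / 2 : ℝ) * R / (4 * R ^ 2 + δ)) * Real.exp (2 * R ^ 2 / δ)
          + 4989 * (Real.sqrt δ + 2 * R) ^ 2 : ℝ) : EReal) ∧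
      (δ ≤ R ^ 2 →
        LogSobolev.optimalConstant (Measure.conv μ (gaussianReal 0 δ.toNNReal)) ≤
          ((7803 * (δ ^ (3 / 2 : ℝ) / R) * Real.exp (2 * R ^ 2 / δ) : ℝ) : EReal)) := by
  have hae : ∀ᵐ y ∂μ, y ∈ Set.Icc a (a + 2 * R) :=
    Filter.mem_of_superset Measure.support_mem_ae hμ
  have hR : 0 ≤ R := by
    obtain ⟨y, hy⟩ := hae.exists
    linarith [hy.1.trans hy.2]
  obtain ⟨σ, hσ, rfl⟩ : ∃ σ : ℝ, 0 < σ ∧ δ = σ ^ 2 :=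
    ⟨√δ, Real.sqrt_pos.2 hδ, (Real.sq_sqrt hδ.le).symm⟩
  have hLSI := LogSobolev.satisfiesLSI_conv_gaussianReal μ hR hσ hae
  rw [LogSobolev.sq_rpow_three_halves hσ, Real.sqrt_sq hσ.le, mul_div_assoc 2 (R ^ 2)]
  -- By scaling, only the ratio `v = R / σ` matters. The proved constant carries `X = exp (v ^ 2)`
  -- and the target `X ^ 2`.
  obtain ⟨v, hv, rfl⟩ : ∃ v : ℝ, 0 ≤ v ∧ R = v * σ := ⟨R / σ, by positivity, by field_simp⟩
  have hu : (v * σ) ^ 2 / σ ^ 2 = v ^ 2 := by field_simp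
  rw [hu] at hLSI ⊢
  set X := Real.exp (v ^ 2) with hX
  have hX2 : Real.exp (2 * v ^ 2) = X ^ 2 := by rw [hX, ← Real.exp_nat_mul]; norm_num
  rw [hX2]
  have hXlow : 1 + v ^ 2 + v ^ 4 / 2 ≤ X := by
    have := Real.quadratic_le_exp_of_nonneg (sq_nonneg v)
    rw [hX]
    nlinarith
  have hX1 : 0 < X := Real.exp_pos _
  -- Here `1458 = 162 * 9`, with `9` from `(1 + 2 * v) ^ 2 ≤ 9 * v ^ 2`, and `1381 = 6905 / 5`, with
  -- `5` from `4 * v ^ 2 + 1 ≤ 5 * v ^ 2`, both for `v ≥ 1`.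
  have hcube : 1458 * v ^ 3 ≤ 1381 * X := by
    nlinarith [mul_nonneg (sq_nonneg v) (sq_nonneg (v - 1))]
  have h9 : 1 ≤ v → (1 + 2 * v) ^ 2 ≤ 9 * v ^ 2 := fun h1 => by nlinarith
  have hlarge : 1 ≤ v → 162 * (1 + 2 * v) ^ 2 * X * v ≤ 1381 * X ^ 2 := fun h1 => by
    calc 162 * (1 + 2 * v) ^ 2 * X * v ≤ 162 * (9 * v ^ 2) * X * v := by gcongr; exact h9 h1
      _ = 1458 * v ^ 3 * X := by ring
      _ ≤ 1381 * X * X := by gcongr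
      _ = _ := by ring
  have e1 : 162 * (σ + 2 * (v * σ)) ^ 2 * X = σ ^ 2 * (162 * (1 + 2 * v) ^ 2 * X) := by ring
  refine ⟨LogSobolev.optimalConstant_le hLSI ?_, fun hle => LogSobolev.optimalConstant_le hLSI ?_⟩
  · have e2 : 6905 * (σ ^ 3 * (v * σ) / (4 * (v * σ) ^ 2 + σ ^ 2)) * X ^ 2
        + 4989 * (σ + 2 * (v * σ)) ^ 2
        = σ ^ 2 * (6905 * (v / (4 * v ^ 2 + 1)) * X ^ 2 + 4989 * (1 + 2 * v) ^ 2) := by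
      field_simp
    rw [e1, e2]
    refine mul_le_mul_of_nonneg_left ?_ (sq_nonneg σ)
    -- For `v ≥ 1` the exponential term alone suffices; for `v ≤ 1`, `X ≤ 3` and `162 * 3 ≤ 4989`,
    -- so the second term alone does.
    rcases le_total 1 v with h1 | h1
    · have h2 : 1 / (5 * v) ≤ v / (4 * v ^ 2 + 1) := by
        rw [div_le_div_iff₀ (by linarith) (by positivity)]
        nlinarith
      have h3 : 162 * (1 + 2 * v) ^ 2 * X ≤ 6905 * (1 / (5 * v)) * X ^ 2 := by
        have h4 : 6905 * (1 / (5 * v)) * X ^ 2 = 1381 * X ^ 2 / v := by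
          field_simp
          norm_num
        rw [h4, le_div_iff₀ (by linarith)]
        exact hlarge h1
      have h5 : 6905 * (1 / (5 * v)) * X ^ 2 ≤ 6905 * (v / (4 * v ^ 2 + 1)) * X ^ 2 := by
        gcongr
      nlinarith [sq_nonneg (1 + 2 * v)]
    · have h2 : X ≤ 3 := by
        have h3 : X ≤ Real.exp 1 := Real.exp_le_exp.2 (by nlinarith)
        linarith [Real.exp_one_lt_d9]
      have h3 : 0 ≤ 6905 * (v / (4 * v ^ 2 + 1)) * X ^ 2 := by positivity
      nlinarith [sq_nonneg (1 + 2 * v), mul_le_mul_of_nonneg_left h2 (sq_nonneg (1 + 2 * v))]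
  · have h1 : 1 ≤ v := by
      rw [mul_pow] at hle
      have : 1 ≤ v ^ 2 := le_of_mul_le_mul_right (by linarith) (pow_pos hσ 2)
      nlinarith
    have e2 : 7803 * (σ ^ 3 / (v * σ)) * X ^ 2 = σ ^ 2 * (7803 * X ^ 2 / v) := by
      field_simp
    rw [e1, e2]
    refine mul_le_mul_of_nonneg_left ?_ (sq_nonneg σ)
    rw [le_div_iff₀ (by linarith)]
    exact (hlarge h1).trans (by gcongr; norm_num)
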